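/- All graphs are finite and simple. Let $G$ be a graph with vertex set $V(G)$ and edge set $E(G)$, and let $g,f:V(G)\to\mathbb{Z}_{>0}$ satisfy $g\le f$. A fractional $(g,f)$-factor of $G$ is given by an indicator function $h:E(G)\to[0,1]$ such that $g(x)\le\sum_{e\in E(G),\,e\ni x}h(e)\le f(x)$ for every $x\in V(G)$. The graph $G$ is called fractional $(g,f)$-covered if for every $e\in E(G)$ there is a fractional $(g,f)$-factor of $G$ whose indicator function $h$ satisfies $h(e)=1$. For an integer $n\ge 0$, $G$ is called fractional $(g,f,n)$-critical covered if for every set $N\subseteq V(G)$ with $|N|=n$ the graph $G-N$ (the subgraph induced by $V(G)\setminus N$, with $g$ and $f$ restricted to it) is fractional $(g,f)$-covered. Let $\delta(G)$ denote the minimum degree and $\alpha(G)$ the independence number of $G$. Theorem 2. Let $a,b,d,n$ be integers with $a\ge 1$, $d\ge 0$, $n\ge 0$ and $b-d\ge\max\{a,2\}$. Let $G$ be a graph of order $p$ with $$p\ge\frac{(a+b-1)(a+b-2)+(a+d)n+1}{a+d},$$ and let $g,f:V(G)\to\mathbb{Z}_{>0}$ satisfy $a\le g(x)\le f(x)-d\le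 b-d$ for all $x\in V(G)$. If $$\delta(G)\ge\frac{(b-d-1)p+(a+d)n+a+b+1}{a+b-1}\quad\text{and}\quad\delta(G)>\frac{(b-d-2)p+2\alpha(G)+(a+d)n+1}{a+b-2},$$ then $G$ is fractional $(g,f,n)$-critical covered. -/

import Mathlib

namespace SimpleGraph

open Classical in
/-- The fractional degree of `x` for a weighting `h` of the edges of `G`: the sum of `h e` over all
edges `e` of `G` incident with `x`. -/
noncomputable def fractionalDegree {V : Type*} [Fintype V] (G : SimpleGraph V)
    (h : G.edgeSet → ℝ) (x : V) : ℝ :=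
  ∑ e ∈ Finset.univ.filter (fun e : G.edgeSet => x ∈ e.val), h e

/-- `h` is the indicator function of a fractional `(g, f)`-factor of `G`: it takes values in
`[0, 1]`, and every fractional degree lies between `g x` and `f x`. -/
def IsFractionalFactor {V : Type*} [Fintype V] (G : SimpleGraph V) (g f : V → ℕ)
    (h : G.edgeSet → ℝ) : Prop :=
  (∀ e, h e ∈ Set.Icc (0 : ℝ) 1) ∧
    ∀ x, (g x : ℝ) ≤ G.fractionalDegree h x ∧ G.fractionalDegree h x ≤ (f x : ℝ)

/-- `G` is fractional `(g, f)`-covered: for every edge `e` there is a fractional `(g, f)`-factor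
whose indicator function takes the value `1` at `e`. -/
def IsFractionalCovered {V : Type*} [Fintype V] (G : SimpleGraph V) (g f : V → ℕ) : Prop :=
  ∀ e : G.edgeSet, ∃ h : G.edgeSet → ℝ, G.IsFractionalFactor g f h ∧ h e = 1

open Classical in
/-- `G` is fractional `(g, f, n)`-critical covered: after removing any `n` vertices, the remaining
induced subgraph, with `g` and `f` restricted to it, is fractional `(g, f)`-covered. -/
def IsFractionalCriticalCovered {V : Type*} [Fintype V] (G : SimpleGraph V) (g f : V → ℕ)
    (n : ℕ) : Prop :=
  ∀ N : Finset V, N.card = n →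
    (G.induce {v : V | v ∉ N}).IsFractionalCovered (fun v => g v) (fun v => f v)

end SimpleGraph

open Finset

/-! Fix an edge `e₀` of the remaining graph. Degree vectors of weightings with value 1 at `e₀` form
a compact convex set; a factor exists unless some linear functional `c` separates that set from the
box `[g, f]`. Non-separation by `c` means `coveredGap` is nonnegative at `c`. This gap is piecewise
linear, so it suffices to test `c` with values in {-1, 0, 1}; there, with S and T the negative and
positive supports, it follows from a Tutte-type deficiency inequality with loss min(|S|, 2).

If that inequality fails for S and T, let h be the least degree outside S over T, so δ ≤ h + |S| +
n. T empty or h ≥ b - d is impossible at once; 1 ≤ h < b - d contradicts the first degree bound and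
the order bound; h = 0 contradicts the second degree bound, because low-degree vertices of T yield a
large independent set. -/

/-! ### Reduction of functionals to sign vectors. -/

/-- Shrinking by `m` crosses no zero. Opposite signs cancel and leave `a + b` unchanged; otherwise
all terms lie on one side of 0, where `max 0` is linear. -/
lemma max_add_eq_of_shrink {a b m : ℝ} (ha : a = 0 ∨ m ≤ |a|)
    (hb : b = 0 ∨ m ≤ |b|) :
    max 0 (a + b) = m * max 0 (Real.sign a + Real.sign b) +
      max 0 ((a - m * Real.sign a) + (b - m * Real.sign b)) := by
  have key : ∀ x : ℝ, (x = 0 ∨ m ≤ |x|) →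
      (x = 0 ∧ Real.sign x = 0) ∨ (0 < x ∧ m ≤ x ∧ Real.sign x = 1) ∨
        (x < 0 ∧ x ≤ -m ∧ Real.sign x = -1) := by
    intro x hx
    rcases lt_trichotomy x 0 with h | h | h
    · right; right
      refine ⟨h, ?_, Real.sign_of_neg h⟩
      rcases hx with hx | hx
      · linarith
      · rw [abs_of_neg h] at hx; linarith
    · left; exact ⟨h, by rw [h, Real.sign_zero]⟩
    · right; left
      refine ⟨h, ?_, Real.sign_of_pos h⟩
      rcases hx with hx | hx
      · linarith
      · rwa [abs_of_pos h] at hx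
  rcases key a ha with ⟨h1, h2⟩ | ⟨h1, h2, h3⟩ | ⟨h1, h2, h3⟩ <;>
  rcases key b hb with ⟨k1, k2⟩ | ⟨k1, k2, k3⟩ | ⟨k1, k2, k3⟩ <;>
  simp only [*] <;> norm_num <;>
  first
  | (rw [max_eq_right (by linarith), max_eq_right (by linarith)]; ring)
  | (rw [max_eq_left (by linarith), max_eq_left (by linarith)])

lemma max_neg_eq_of_shrink {a m : ℝ} (ha : a = 0 ∨ m ≤ |a|) :
    max 0 (-a) = m * max 0 (-Real.sign a) + max 0 (-(a - m * Real.sign a)) := by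
  have := max_add_eq_of_shrink (a := -a) (b := 0) (by simpa using ha) (Or.inl rfl)
  have e : Real.sign (-a) = - Real.sign a := Real.sign_neg
  simp only [e, Real.sign_zero, add_zero, mul_zero, sub_zero] at this
  rw [this]; ring_nf

namespace SimpleGraph

variable {W : Type*} [Fintype W]

open Classical in
/-- The sum of the potential `c` over the two ends of the edge `e`. -/
noncomputable def endSum (H : SimpleGraph W) (c : W → ℝ) (e : H.edgeSet) : ℝ :=
  ∑ x ∈ univ.filter (fun x => x ∈ e.val), c x

open Classical in
lemma filter_mem_mk (u v : W) :
    univ.filter (fun x => x ∈ s(u, v)) = {u, v} := by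
  ext x; simp

lemma endSum_mk (H : SimpleGraph W) (c : W → ℝ) {u v : W} (huv : H.Adj u v) :
    H.endSum c ⟨s(u, v), huv⟩ = c u + c v := by
  classical
  unfold endSum
  rw [filter_mem_mk, sum_pair huv.ne]

open Classical in
/-- The support function of the set of fractional degree vectors of weightings that take the
value `1` at `e₀`, minus the least value of the pairing on the box `[g, f]`. -/
noncomputable def coveredGap (H : SimpleGraph W) (g f : W → ℕ) (e₀ : H.edgeSet) (c : W → ℝ) : ℝ :=
  (∑ e, max 0 (H.endSum c e)) - max 0 (- H.endSum c e₀) +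
    ∑ x, (max 0 (-c x) * f x - max 0 (c x) * g x)

lemma coveredGap_shrink (H : SimpleGraph W) (g f : W → ℕ) (e₀ : H.edgeSet) (c : W → ℝ) {m : ℝ}
    (hc : ∀ x, c x = 0 ∨ m ≤ |c x|) :
    H.coveredGap g f e₀ c = m * H.coveredGap g f e₀ (fun x => Real.sign (c x)) +
      H.coveredGap g f e₀ (fun x => c x - m * Real.sign (c x)) := by
  classical
  have h1 : ∀ e, max 0 (H.endSum c e) = m * max 0 (H.endSum (fun x => Real.sign (c x)) e) +
      max 0 (H.endSum (fun x => c x - m * Real.sign (c x)) e) := by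
    rintro ⟨e, he⟩
    induction e with
    | _ u v =>
      rw [endSum_mk H _ he, endSum_mk H _ he, endSum_mk H _ he]
      exact max_add_eq_of_shrink (hc u) (hc v)
  have h2 : ∀ e, max 0 (-H.endSum c e) = m * max 0 (-H.endSum (fun x => Real.sign (c x)) e) +
      max 0 (-H.endSum (fun x => c x - m * Real.sign (c x)) e) := by
    rintro ⟨e, he⟩
    induction e with
    | _ u v =>
      rw [endSum_mk H _ he, endSum_mk H _ he, endSum_mk H _ he]
      have := max_add_eq_of_shrink (a := -c u) (b := -c v) (by simpa using hc u)
        (by simpa using hc v)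
      simp only [Real.sign_neg] at this
      convert this using 3 <;> ring_nf
  have h3 : ∀ x, max 0 (-c x) * f x - max 0 (c x) * g x =
      m * (max 0 (-Real.sign (c x)) * f x - max 0 (Real.sign (c x)) * g x) +
      (max 0 (-(c x - m * Real.sign (c x))) * f x - max 0 (c x - m * Real.sign (c x)) * g x) := by
    intro x
    have e1 := max_neg_eq_of_shrink (hc x)
    have e2 := max_add_eq_of_shrink (b := 0) (hc x) (Or.inl rfl)
    simp only [Real.sign_zero, add_zero, mul_zero, sub_zero] at e2
    rw [e1, e2]; ring
  unfold coveredGap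
  rw [h2 e₀, sum_congr rfl fun e _ => h1 e, sum_congr rfl fun x _ => h3 x,
    sum_add_distrib, sum_add_distrib, ← mul_sum, ← mul_sum]
  ring

/-- Peeling off the sign vector, scaled by the least nonzero |c x|, makes a further entry vanish;
hence induction on the support. -/
lemma coveredGap_nonneg_of_sign (H : SimpleGraph W) (g f : W → ℕ) (e₀ : H.edgeSet)
    (hs : ∀ c : W → ℝ, 0 ≤ H.coveredGap g f e₀ (fun x => Real.sign (c x))) (c : W → ℝ) :
    0 ≤ H.coveredGap g f e₀ c := by
  classical
  induction hk : (univ.filter (fun x => c x ≠ 0)).card using Nat.strong_induction_on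
    generalizing c with
  | _ k ih =>
    by_cases hne : (univ.filter (fun x => c x ≠ 0)).Nonempty
    · obtain ⟨x₀, hx₀, hmin⟩ := exists_min_image _ (fun x => |c x|) hne
      have hx₀' : c x₀ ≠ 0 := (mem_filter.1 hx₀).2
      have hc : ∀ x, c x = 0 ∨ |c x₀| ≤ |c x| := by
        intro x
        by_cases h : c x = 0
        · exact Or.inl h
        · exact Or.inr (hmin x (by simp [h]))
      rw [coveredGap_shrink H g f e₀ c hc]
      have : 0 ≤ H.coveredGap g f e₀ (fun x => c x - |c x₀| * Real.sign (c x)) := by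
        refine ih _ ?_ _ rfl
        rw [← hk]
        refine card_lt_card ((ssubset_iff_of_subset ?_).2 ⟨x₀, hx₀, ?_⟩)
        · intro x hx
          simp only [mem_filter, mem_univ, true_and] at hx ⊢
          intro h
          exact hx (by simp [h])
        · simp only [mem_filter, mem_univ, true_and, not_not]
          rcases lt_or_gt_of_ne hx₀' with h | h
          · rw [abs_of_neg h, Real.sign_of_neg h]; ring
          · rw [abs_of_pos h, Real.sign_of_pos h]; ring
      have := mul_nonneg (abs_nonneg (c x₀)) (hs c)
      linarith
    · have h0 : c = fun x => Real.sign ((0 : W → ℝ) x) := by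
        funext x
        by_contra h
        exact hne ⟨x, by simpa using h⟩
      rw [h0]
      exact hs 0

/-! ### Sign vectors and the deficiency inequality. -/

open Classical in
/-- The number of neighbours of `x` in `H` outside `S`. -/
noncomputable def degreeOutside (H : SimpleGraph W) (S : Finset W) (x : W) : ℕ :=
  (univ.filter (fun y => H.Adj x y ∧ y ∉ S)).card

open Classical in
lemma degreeOutside_le (H : SimpleGraph W) (S : Finset W) (x : W) (hx : x ∉ S) :
    H.degreeOutside S x ≤
      (univ.filter (fun e : H.edgeSet => x ∈ e.val ∧ ∀ y ∈ e.val, y ∉ S)).card := by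
  unfold degreeOutside
  rw [← card_map (Function.Embedding.subtype _)]
  refine card_le_card_of_injOn (fun y => s(x, y)) ?_ ?_
  · intro y hy
    simp only [coe_filter, mem_univ, true_and, Set.mem_ofPred_eq] at hy
    simp only [coe_map, Set.mem_image, coe_filter, mem_univ, true_and, Set.mem_ofPred_eq]
    exact ⟨⟨s(x, y), hy.1⟩, ⟨by simp, by simp [hx, hy.2]⟩, rfl⟩
  · intro y _ z _ h
    exact Sym2.congr_right.1 h

lemma mem_of_degreeOutside_eq_zero (H : SimpleGraph W) {S : Finset W} {x y : W}
    (h : H.degreeOutside S x = 0) (hxy : H.Adj x y) : y ∈ S := by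
  classical
  by_contra hy
  rw [degreeOutside, card_eq_zero] at h
  exact notMem_empty y (h ▸ mem_filter.2 ⟨mem_univ _, hxy, hy⟩)

lemma eq_of_degreeOutside_le_one (H : SimpleGraph W) {S : Finset W} {x y z : W}
    (h : H.degreeOutside S x ≤ 1) (hxy : H.Adj x y) (hxz : H.Adj x z) (hy : y ∉ S) (hz : z ∉ S) :
    y = z := by
  classical
  rw [degreeOutside, card_le_one] at h
  exact h y (mem_filter.2 ⟨mem_univ _, hxy, hy⟩) z (mem_filter.2 ⟨mem_univ _, hxz, hz⟩)

lemma coveredGap_sign_nonneg (H : SimpleGraph W) (g f : W → ℕ) (e₀ : H.edgeSet)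
    (hyp : ∀ S T : Finset W, Disjoint S T →
      ∑ x ∈ T, g x + min S.card 2 ≤ ∑ x ∈ S, f x + ∑ x ∈ T, H.degreeOutside S x) (c : W → ℝ) :
    0 ≤ H.coveredGap g f e₀ (fun x => Real.sign (c x)) := by
  classical
  set S : Finset W := univ.filter (fun x => c x < 0) with hS
  set T : Finset W := univ.filter (fun x => 0 < c x) with hT
  have memS : ∀ x, x ∈ S ↔ c x < 0 := by simp [hS]
  have memT : ∀ x, x ∈ T ↔ 0 < c x := by simp [hT]
  have hST : Disjoint S T := by
    rw [Finset.disjoint_left]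
    intro x h1 h2
    rw [memS] at h1; rw [memT] at h2
    linarith
  have hsign : ∀ x, Real.sign (c x) = (if x ∈ T then 1 else 0) - (if x ∈ S then 1 else 0) := by
    intro x
    rcases lt_trichotomy (c x) 0 with h | h | h
    · rw [Real.sign_of_neg h, if_neg (by rw [memT]; linarith), if_pos ((memS x).2 h)]; norm_num
    · rw [h, Real.sign_zero, if_neg (by rw [memT]; linarith), if_neg (by rw [memS]; linarith)]
      norm_num
    · rw [Real.sign_of_pos h, if_pos ((memT x).2 h), if_neg (by rw [memS]; linarith)]; norm_num
  have hdis : ∀ x, x ∈ S → x ∉ T := fun x h => Finset.disjoint_left.1 hST h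
  have hedges : ((∑ x ∈ T, H.degreeOutside S x : ℕ) : ℝ) ≤
      ∑ e, max 0 (H.endSum (fun x => Real.sign (c x)) e) := by
    have h1 : ((∑ x ∈ T, H.degreeOutside S x : ℕ) : ℝ) ≤ ∑ x ∈ T, ∑ e : H.edgeSet,
        (if x ∈ e.val ∧ ∀ y ∈ e.val, y ∉ S then (1 : ℝ) else 0) := by
      push_cast
      refine sum_le_sum fun x hx => ?_
      rw [sum_boole]
      exact_mod_cast H.degreeOutside_le S x (fun h => hdis x h hx)
    refine h1.trans ?_
    rw [sum_comm]
    refine sum_le_sum ?_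
    rintro ⟨e, he⟩ -
    induction e with
    | _ u v =>
      rw [endSum_mk H _ he]
      have huv : u ≠ v := H.ne_of_adj he
      by_cases hu : u ∈ S
      · rw [sum_eq_zero]
        · exact le_max_left _ _
        · intro x _
          rw [if_neg]
          intro h
          exact h.2 u (by simp) hu
      by_cases hv : v ∈ S
      · rw [sum_eq_zero]
        · exact le_max_left _ _
        · intro x _
          rw [if_neg]
          intro h
          exact h.2 v (by simp) hv
      refine le_trans ?_ (le_max_right _ _)
      rw [hsign, hsign, if_neg hu, if_neg hv, sub_zero, sub_zero]
      have : ∀ x ∈ T, (if x ∈ s(u, v) ∧ ∀ y ∈ s(u, v), y ∉ S then (1 : ℝ) else 0) =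
          (if x = u then 1 else 0) + (if x = v then 1 else 0) := by
        intro x _
        by_cases h1 : x = u
        · subst h1; simp [hu, hv, huv]
        · by_cases h2 : x = v
          · subst h2; simp [hu, hv, h1]
          · simp [h1, h2]
      rw [sum_congr rfl this, sum_add_distrib, sum_ite_eq', sum_ite_eq']
  -- Forcing `e₀` costs at most the number of its ends in S.
  have hedge₀ : max 0 (-H.endSum (fun x => Real.sign (c x)) e₀) ≤ ((min S.card 2 : ℕ) : ℝ) := by
    refine max_le (by positivity) ?_
    obtain ⟨e, he⟩ := e₀
    induction e with
    | _ u v =>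
      rw [endSum_mk H _ he, hsign, hsign]
      have huv : u ≠ v := H.ne_of_adj he
      have h1 : -(((if u ∈ T then (1 : ℝ) else 0) - (if u ∈ S then 1 else 0)) +
          ((if v ∈ T then 1 else 0) - (if v ∈ S then 1 else 0))) ≤
          ((({u, v} : Finset W).filter (· ∈ S)).card : ℕ) := by
        rw [card_filter, sum_pair huv]
        push_cast
        split_ifs <;> norm_num
      refine h1.trans ?_
      norm_cast
      refine le_min (card_le_card fun x hx => (mem_filter.1 hx).2) ?_
      exact (card_filter_le _ _).trans card_le_two
  have hvert : ∑ x, (max 0 (-Real.sign (c x)) * f x - max 0 (Real.sign (c x)) * g x) =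
      ((∑ x ∈ S, f x : ℕ) : ℝ) - ((∑ x ∈ T, g x : ℕ) : ℝ) := by
    have : ∀ x, max 0 (-Real.sign (c x)) * f x - max 0 (Real.sign (c x)) * g x =
        (if x ∈ S then (f x : ℝ) else 0) - (if x ∈ T then (g x : ℝ) else 0) := by
      intro x
      rw [hsign]
      by_cases h1 : x ∈ S
      · simp [h1, hdis x h1]
      · by_cases h2 : x ∈ T <;> simp [h1, h2]
    rw [sum_congr rfl fun x _ => this x, sum_sub_distrib]
    simp
  have h := hyp S T hST
  have h' : ((∑ x ∈ T, g x : ℕ) : ℝ) + ((min S.card 2 : ℕ) : ℝ) ≤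
    ((∑ x ∈ S, f x : ℕ) : ℝ) + ((∑ x ∈ T, H.degreeOutside S x : ℕ) : ℝ) := by exact_mod_cast h
  unfold coveredGap
  rw [hvert]
  linarith

/-! ### Separation of degree vectors from the box. -/

open Classical in
lemma sum_mul_fractionalDegree (H : SimpleGraph W) (c : W → ℝ) (h : H.edgeSet → ℝ) :
    ∑ x, c x * H.fractionalDegree h x = ∑ e, h e * H.endSum c e := by
  unfold fractionalDegree endSum
  simp only [mul_sum, sum_filter]
  rw [sum_comm]
  refine sum_congr rfl fun e _ => sum_congr rfl fun x _ => ?_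
  split_ifs <;> ring

/-- If `(g, f)` satisfies the deficiency condition strengthened by `min |S| 2`, then `H` is
fractional `(g, f)`-covered. -/
theorem isFractionalCovered_of_forall_disjoint (H : SimpleGraph W) (g f : W → ℕ)
    (hgf : ∀ x, g x ≤ f x)
    (hyp : ∀ S T : Finset W, Disjoint S T →
      ∑ x ∈ T, g x + min S.card 2 ≤ ∑ x ∈ S, f x + ∑ x ∈ T, H.degreeOutside S x) :
    H.IsFractionalCovered g f := by
  classical
  intro e₀
  -- The two bounds agree at `e₀`, which forces the value 1 there.
  let K : Set (H.edgeSet → ℝ) := Set.Icc (Pi.single e₀ 1) 1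
  let D : (H.edgeSet → ℝ) →ₗ[ℝ] (W → ℝ) :=
    { toFun := fun h x => H.fractionalDegree h x
      map_add' := by intro h k; funext x; simp [fractionalDegree, sum_add_distrib]
      map_smul' := by intro r h; funext x; simp [fractionalDegree, mul_sum] }
  let B : Set (W → ℝ) := Set.Icc (fun x => (g x : ℝ)) (fun x => (f x : ℝ))
  have hD : Continuous D := LinearMap.continuous_of_finiteDimensional D
  by_cases hdisj : Disjoint (D '' K) B
  · exfalso
    obtain ⟨φ, u, v, h1, huv, h2⟩ := geometric_hahn_banach_compact_closed
      ((convex_Icc _ _).linear_image D) (isCompact_Icc.image hD) (convex_Icc _ _) isClosed_Icc hdisj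
    set c : W → ℝ := fun x => φ (Pi.single x 1) with hc
    have hφ : ∀ y, φ y = ∑ x, c x * y x := by
      intro y
      have := LinearMap.pi_apply_eq_sum_univ (φ : (W → ℝ) →ₗ[ℝ] ℝ) y
      simp only [ContinuousLinearMap.coe_coe] at this
      rw [this]
      refine sum_congr rfl fun x _ => ?_
      rw [smul_eq_mul, mul_comm, hc]
      congr 2
      funext j
      simp [Pi.single_apply, eq_comm]
    -- `h` maximises the pairing with `c` over `K`, and `y` minimises it over `B`.
    let h : H.edgeSet → ℝ := fun e => if e = e₀ ∨ 0 ≤ H.endSum c e then 1 else 0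
    let y : W → ℝ := fun x => if 0 ≤ c x then g x else f x
    have hK : h ∈ K := by
      constructor
      · intro e
        by_cases he : e = e₀
        · subst he; simp [h]
        · simp only [Pi.single_eq_of_ne he, h]; split_ifs <;> norm_num
      · intro e
        simp only [h, Pi.one_apply]; split_ifs <;> norm_num
    have hB : y ∈ B := by
      constructor <;> intro x <;> simp only [y] <;> split_ifs <;>
        first | exact le_rfl | exact_mod_cast hgf x
    have h3 := h1 _ ⟨h, hK, rfl⟩
    have h4 := h2 _ hB
    have h5 := coveredGap_nonneg_of_sign H g f e₀ (coveredGap_sign_nonneg H g f e₀ hyp) c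
    have e1 : φ (D h) = (∑ e, max 0 (H.endSum c e)) - max 0 (- H.endSum c e₀) := by
      rw [hφ]
      change ∑ x, c x * H.fractionalDegree h x = _
      rw [sum_mul_fractionalDegree]
      have : ∀ e, h e * H.endSum c e =
          max 0 (H.endSum c e) - if e = e₀ then max 0 (- H.endSum c e) else 0 := by
        intro e
        simp only [h]
        by_cases he : e = e₀
        · rw [if_pos (Or.inl he), if_pos he, one_mul]
          rcases le_total 0 (H.endSum c e) with h | h
          · rw [max_eq_right h, max_eq_left (by linarith)]; ring
          · rw [max_eq_left h, max_eq_right (by linarith)]; ring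
        · by_cases h : 0 ≤ H.endSum c e
          · rw [if_pos (Or.inr h), if_neg he, max_eq_right h]; ring
          · rw [if_neg (by tauto), if_neg he, max_eq_left (by linarith)]; ring
      rw [sum_congr rfl fun e _ => this e, sum_sub_distrib]
      simp
    have e2 : φ y = - ∑ x, (max 0 (-c x) * f x - max 0 (c x) * g x) := by
      rw [hφ, ← sum_neg_distrib]
      refine sum_congr rfl fun x _ => ?_
      simp only [y]
      split_ifs with h
      · rw [max_eq_right h, max_eq_left (by linarith)]; ring
      · rw [max_eq_right (by linarith : 0 ≤ -c x), max_eq_left (by linarith : c x ≤ 0)]; ring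
    unfold coveredGap at h5
    linarith
  · obtain ⟨_, ⟨h, hK, rfl⟩, hB⟩ := Set.not_disjoint_iff.1 hdisj
    refine ⟨h, ⟨fun e => ⟨?_, hK.2 e⟩, fun x => ⟨hB.1 x, hB.2 x⟩⟩, le_antisymm (hK.2 e₀) ?_⟩
    · refine le_trans ?_ (hK.1 e)
      by_cases he : e = e₀
      · subst he; simp
      · simp [Pi.single_eq_of_ne he]
    · simpa using hK.1 e₀

end SimpleGraph

/-! ### Degree and independence bounds after deleting vertices. -/

namespace SimpleGraph

/-- In a set of vertices each having at most one neighbour inside the set, there is an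
independent set containing at least half of the vertices, isolated ones counted twice. -/
theorem exists_isIndepSet_of_degree_le_one {V : Type*} (H : SimpleGraph V) (I I₀ : Finset V) (h₀ : I₀ ⊆ I)
    (hI₀ : ∀ x ∈ I₀, ∀ y ∈ I, ¬ H.Adj x y)
    (hI : ∀ x ∈ I, ∀ y ∈ I, ∀ z ∈ I, H.Adj x y → H.Adj x z → y = z) :
    ∃ J ⊆ I, H.IsIndepSet J ∧ I.card + I₀.card ≤ 2 * J.card := by
  classical
  obtain ⟨J, hJ⟩ := (I.powerset.filter (fun J : Finset V => H.IsIndepSet J)).exists_maximal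
    ⟨∅, by simp [IsIndepSet]⟩
  have hJ1 := hJ.1
  simp only [mem_filter, mem_powerset] at hJ1
  obtain ⟨hJI, hind⟩ := hJ1
  have hadj : ∀ x ∈ I \ J, ∃ y ∈ J, H.Adj x y := by
    intro x hx
    obtain ⟨hxI, hxJ⟩ := mem_sdiff.1 hx
    by_contra! hno
    have hmem : insert x J ∈ I.powerset.filter (fun J : Finset V => H.IsIndepSet J) := by
      simp only [mem_filter, mem_powerset]
      refine ⟨insert_subset hxI hJI, ?_⟩
      rw [coe_insert]
      refine hind.insert fun y hy _ => ⟨hno y hy, fun h => hno y hy h.symm⟩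
    exact hxJ (hJ.2 hmem (subset_insert x J) (mem_insert_self x J))
  choose! m hmJ hm using hadj
  have h₀J : I₀ ⊆ J := by
    intro x hx
    by_contra h
    have hxs : x ∈ I \ J := mem_sdiff.2 ⟨h₀ hx, h⟩
    exact hI₀ x hx _ (hJI (hmJ x hxs)) (hm x hxs)
  -- Each vertex left out of the maximal J has a neighbour in J, and no two share one.
  have hcard : (I \ J).card ≤ (J \ I₀).card := by
    refine card_le_card_of_injOn m ?_ ?_
    · intro x hx
      refine mem_coe.2 (mem_sdiff.2 ⟨hmJ x hx, fun h => ?_⟩)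
      exact hI₀ _ h x (mem_sdiff.1 hx).1 (hm x hx).symm
    · intro x hx y hy hxy
      have hy' := (hm y hy).symm
      rw [← hxy] at hy'
      exact hI (m x) (hJI (hmJ x hx)) x (mem_sdiff.1 hx).1 y (mem_sdiff.1 hy).1
        (hm x hx).symm hy'
  refine ⟨J, hJI, hind, ?_⟩
  have h1 := card_sdiff_add_card_eq_card hJI
  have h2 := card_sdiff_add_card_eq_card h₀J
  omega

variable {V : Type*} [Fintype V]

lemma minDegree_le_degreeOutside_induce (G : SimpleGraph V) [DecidableRel G.Adj] (N : Finset V)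
    [Fintype {v : V | v ∉ N}] (S : Finset {v : V | v ∉ N}) (x : {v : V | v ∉ N}) :
    G.minDegree ≤ (G.induce {v : V | v ∉ N}).degreeOutside S x + S.card + N.card := by
  classical
  refine (G.minDegree_le_degree x.val).trans ?_
  rw [← G.card_neighborFinset_eq_degree]
  set A := univ.filter (fun y => (G.induce {v : V | v ∉ N}).Adj x y ∧ y ∉ S) with hA
  have hAk : (G.induce {v : V | v ∉ N}).degreeOutside S x = A.card := by
    unfold degreeOutside
    congr
  rw [hAk]
  have hsub : G.neighborFinset x.val ⊆
      (A.map (Function.Embedding.subtype _) ∪ S.map (Function.Embedding.subtype _)) ∪ N := by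
    intro y hy
    rw [mem_neighborFinset] at hy
    by_cases hyN : y ∈ N
    · exact mem_union_right _ hyN
    · refine mem_union_left _ ?_
      by_cases hyS : (⟨y, hyN⟩ : {v : V | v ∉ N}) ∈ S
      · exact mem_union_right _ (mem_map.2 ⟨_, hyS, rfl⟩)
      · exact mem_union_left _ (mem_map.2 ⟨⟨y, hyN⟩, by simp [hA, hy, hyS], rfl⟩)
  refine (card_le_card hsub).trans ((card_union_le _ _).trans ?_)
  refine Nat.add_le_add_right ((card_union_le _ _).trans ?_) _
  rw [card_map, card_map]

lemma card_induce_add_card (N : Finset V) [Fintype {v : V | v ∉ N}] :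
    Fintype.card {v : V | v ∉ N} + N.card = Fintype.card V := by
  classical
  have h1 : Fintype.card {v : V | v ∉ N} = (Nᶜ).card := by
    rw [Fintype.card_of_subtype]
    simp
  rw [h1, card_compl_add_card]

lemma card_le_indepNum_of_induce (G : SimpleGraph V) (s : Set V) (J : Finset s)
    (hJ : (G.induce s).IsIndepSet J) : J.card ≤ G.indepNum := by
  classical
  rw [← card_map (Function.Embedding.subtype _)]
  apply IsIndepSet.card_le_indepNum
  intro x hx y hy hxy
  obtain ⟨x', hx', rfl⟩ := mem_map.1 (mem_coe.1 hx)
  obtain ⟨y', hy', rfl⟩ := mem_map.1 (mem_coe.1 hy)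
  exact hJ hx' hy' (fun h => hxy (by rw [h]))

lemma two_mul_card_le_sum_degreeOutside (G : SimpleGraph V) (s : Set V) [Fintype s]
    (S T : Finset s) (hST : Disjoint S T) :
    2 * T.card ≤ ∑ x ∈ T, (G.induce s).degreeOutside S x + 2 * G.indepNum := by
  classical
  set k := (G.induce s).degreeOutside S with hk
  have hnotS : ∀ x ∈ T, x ∉ S := fun x hx h => Finset.disjoint_left.1 hST h hx
  obtain ⟨J, -, hJ, hcard⟩ := exists_isIndepSet_of_degree_le_one (G.induce s)
    (T.filter (fun x => k x ≤ 1)) (T.filter (fun x => k x = 0))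
    (fun x hx => by
      simp only [mem_filter] at hx ⊢
      exact ⟨hx.1, by omega⟩)
    (fun x hx y hy hxy => by
      exact hnotS y (mem_filter.1 hy).1
        ((G.induce s).mem_of_degreeOutside_eq_zero (mem_filter.1 hx).2 hxy))
    (fun x hx y hy z hz hxy hxz =>
      (G.induce s).eq_of_degreeOutside_le_one (mem_filter.1 hx).2 hxy hxz
        (hnotS y (mem_filter.1 hy).1) (hnotS z (mem_filter.1 hz).1))
  have hα := card_le_indepNum_of_induce G s J hJ
  have hsum : 2 * T.card ≤ ∑ x ∈ T, k x + ((T.filter (fun x => k x ≤ 1)).card +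
      (T.filter (fun x => k x = 0)).card) := by
    rw [card_filter, card_filter, ← sum_add_distrib, ← sum_add_distrib, mul_comm,
      ← smul_eq_mul, ← sum_const]
    -- Pointwise, 2 ≤ k + [k ≤ 1] + [k = 0].
    refine sum_le_sum fun x _ => ?_
    split_ifs <;> omega
  omega

end SimpleGraph

/-! ### Arithmetic and conclusion. -/

lemma not_degree_bound_of_between {a b d n p δ s t h : ℤ} (ha : 1 ≤ a) (hd : 0 ≤ d)
    (hp : (a + b - 1) * (a + b - 2) + (a + d) * n + 1 ≤ p * (a + d))
    (hδ : (b - d - 1) * p + (a + d) * n + a + b + 1 ≤ δ * (a + b - 1))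
    (h1 : 1 ≤ h) (h2 : h ≤ b - d - 1) (hδh : δ ≤ h + s + n) (hst : s + t + n ≤ p)
    (hgap : (a + d) * s + (h - (b - d)) * t ≤ 1) : False := by
  -- Eliminate t by t ≤ p - n - s, then s by s ≥ δ - h - n.
  have e1 : (a + b - h) * s ≤ (b - d - h) * (p - n) + 1 := by
    nlinarith [mul_nonneg (by linarith : (0 : ℤ) ≤ b - d - h) (by linarith : 0 ≤ p - n - s - t)]
  have e2 : (a + b - h) * δ ≤ (a + b - h) * h + (a + d) * n + (b - d - h) * p + 1 := by
    nlinarith [mul_nonneg (by linarith : (0 : ℤ) ≤ a + b - h)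
      (by linarith : 0 ≤ h + s + n - δ)]
  have hM : 0 < a + b - 1 := by linarith
  have hMh : 0 < a + b - h := by linarith
  have e3 := mul_le_mul_of_nonneg_left e2 hM.le
  have e4 := mul_le_mul_of_nonneg_left hδ hMh.le
  have e5 := mul_le_mul_of_nonneg_left hp (by linarith : 0 ≤ h - 1)
  -- Integrality of h matters here. The bounds combine to (a + b - 1)(h - 1)(h - 2) + (a + b - h) ≤
  -- 0, which is absurd.
  have e6 : 0 ≤ (h - 1) * (h - 2) := by
    rcases h1.eq_or_lt with h | h
    · rw [← h]; norm_num
    · exact mul_nonneg (by linarith) (by linarith)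
  have e7 := mul_nonneg hM.le e6
  nlinarith

theorem theorem2 {V : Type*} [Fintype V] (G : SimpleGraph V) [DecidableRel G.Adj]
    (a b d : ℤ) (n p : ℕ) (ha : 1 ≤ a) (hd : 0 ≤ d) (hbd : max a 2 ≤ b - d)
    (hV : Fintype.card V = p)
    (hp : (((a : ℝ) + b - 1) * (a + b - 2) + (a + d) * n + 1) / (a + d) ≤ (p : ℝ))
    (g f : V → ℕ)
    (hgf : ∀ x, a ≤ (g x : ℤ) ∧ (g x : ℤ) ≤ (f x : ℤ) - d ∧ (f x : ℤ) - d ≤ b - d)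
    (hδ₁ : (((b : ℝ) - d - 1) * p + (a + d) * n + a + b + 1) / (a + b - 1) ≤ (G.minDegree : ℝ))
    (hδ₂ : (((b : ℝ) - d - 2) * p + 2 * (G.indepNum : ℝ) + (a + d) * n + 1) / (a + b - 2)
      < (G.minDegree : ℝ)) :
    G.IsFractionalCriticalCovered g f n := by

  classical
  intro N hN
  have hb2 : 2 ≤ b - d := (le_max_right a 2).trans hbd
  have hab : a ≤ b - d := (le_max_left a 2).trans hbd
  have hp' : (a + b - 1) * (a + b - 2) + (a + d) * n + 1 ≤ p * (a + d) := by
    have h0 : (0 : ℝ) < a + d := by exact_mod_cast (by linarith : 0 < a + d)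
    rw [div_le_iff₀ h0] at hp
    exact_mod_cast hp
  have hδ₁' : (b - d - 1) * p + (a + d) * n + a + b + 1 ≤ G.minDegree * (a + b - 1) := by
    have h0 : (0 : ℝ) < a + b - 1 := by exact_mod_cast (by linarith : 0 < a + b - 1)
    rw [div_le_iff₀ h0] at hδ₁
    exact_mod_cast hδ₁
  have hδ₂' : (b - d - 2) * p + 2 * G.indepNum + (a + d) * n + 1 < G.minDegree * (a + b - 2) := by
    have h0 : (0 : ℝ) < a + b - 2 := by exact_mod_cast (by linarith : 0 < a + b - 2)
    rw [div_lt_iff₀ h0] at hδ₂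
    exact_mod_cast hδ₂
  refine SimpleGraph.isFractionalCovered_of_forall_disjoint _ _ _ (fun x => ?_) ?_
  · have := hgf x
    omega
  intro S T hST
  have hdeg := fun x => G.minDegree_le_degreeOutside_induce N S x
  have hind := G.two_mul_card_le_sum_degreeOutside _ S T hST
  set k := (G.induce {v : V | v ∉ N}).degreeOutside S with hk
  have hst : (S.card : ℤ) + T.card + n ≤ p := by
    have h1 := card_le_univ (S ∪ T)
    rw [card_union_of_disjoint hST] at h1
    have h2 := SimpleGraph.card_induce_add_card N
    rw [hV, hN] at h2
    exact_mod_cast (by omega : S.card + T.card + n ≤ p)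
  have hS : (a + d) * S.card ≤ ∑ x ∈ S, (f x : ℤ) := by
    rw [mul_comm, ← nsmul_eq_mul]
    exact card_nsmul_le_sum _ _ _ fun x _ => by have := hgf x; omega
  have hT : ∑ x ∈ T, (g x : ℤ) ≤ (b - d) * T.card := by
    rw [mul_comm, ← nsmul_eq_mul]
    exact sum_le_card_nsmul _ _ _ fun x _ => by have := hgf x; omega
  by_contra! hlt
  zify at hlt hind
  have hs0 : (0 : ℤ) ≤ S.card := Int.natCast_nonneg _
  have hm1 : min (S.card : ℤ) 2 ≤ S.card := min_le_left _ _
  have hm2 : min (S.card : ℤ) 2 ≤ 2 := min_le_right _ _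
  have hsum : ∀ h : ℤ, (∀ x ∈ T, h ≤ k x) → h * T.card ≤ ∑ x ∈ T, (k x : ℤ) := by
    intro h hh
    rw [mul_comm, ← nsmul_eq_mul]
    exact card_nsmul_le_sum _ _ _ hh
  -- Since a + d ≥ 1, the f-sum over S alone pays for min(|S|, 2).
  have hbig : (b - d) * T.card ≤ ∑ x ∈ T, (k x : ℤ) → False := by
    intro h
    nlinarith [mul_nonneg (by linarith : 0 ≤ a + d - 1) hs0]
  rcases T.eq_empty_or_nonempty with hTe | hTne
  · exact hbig (by simp [hTe])
  obtain ⟨x₀, hx₀, hmin⟩ := exists_min_image T k hTne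
  have hd₀ : (G.minDegree : ℤ) ≤ k x₀ + S.card + n := by
    have := hdeg x₀
    rw [hN] at this
    exact_mod_cast this
  have hsum₀ := hsum (k x₀) (fun x hx => by exact_mod_cast hmin x hx)
  by_cases hge : b - d ≤ k x₀
  · exact hbig (hsum _ fun x hx => hge.trans (by exact_mod_cast hmin x hx))
  by_cases h0 : k x₀ = 0
  · rw [h0] at hd₀
    -- The final 1 is the loss 2 less one for strictness over ℤ.
    have e1 : (a + d) * S.card ≤ (b - d - 2) * T.card + 2 * G.indepNum + 1 := by linarith
    have e2 := mul_nonneg (by linarith : 0 ≤ b - d - 2)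
      (by linarith : 0 ≤ (p : ℤ) - n - S.card - T.card)
    have e3 := mul_nonneg (by linarith : 0 ≤ a + b - 2)
      (by push_cast at hd₀; linarith : 0 ≤ (S.card : ℤ) + n - G.minDegree)
    nlinarith
  · exact not_degree_bound_of_between ha hd hp' hδ₁' (h := k x₀) (by omega) (by omega) hd₀ hst
      (by linarith)
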